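/- **Theorem 4.1.** For $n\ge 1$ and $A\in\mathbb C^{n\times n}$ let $W(A)=\{\langle Ax,x\rangle : x\in\mathbb C^n,\ \|x\|=1\}$ be the numerical range of $A$. Call a subset of $\mathbb C$ *bi-elliptical* if it is the convex hull of two non-degenerate ellipses (circles allowed) with distinct centers, neither of which lies in the closed elliptical disk bounded by the other. Let $u\in\mathbb R$, $b_1,b_2\in\mathbb C$ and $b\ge 0$, put $\xi_j=\operatorname{Re} b_j$, $\eta_j=\operatorname{Im} b_j$ ($j=1,2$), $B=\begin{bmatrix} b_1 & b\\ 0& b_2\end{bmatrix}$, and let $$A=\begin{bmatrix} uI & B^*+I\\ B-I & -uI\end{bmatrix}=\begin{bmatrix} u & 0 & \overline{b_1}+1 & 0\\ 0 & u & b & \overline{b_2}+1\\ b_1-1 & b & -u & 0\\ 0 & b_2-1 & 0 & -u\end{bmatrix}.$$ Then $W(A)$ is bi-elliptical if and only if $b\neq 0$ and at least one of the following holds: (i) $\eta_1=\eta_2$ and $4b^2u^2=(\xi_1^2-\xi_2^2)^2$; (ii) $u=\xi_1=\xi_2=0$. -/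

import Mathlib

/-- The numerical range `W(A) = {⟨Ax, x⟩ : x ∈ ℂⁿ, ‖x‖ = 1}` of a complex square matrix.
Mathlib's inner product is linear in its second argument, so `⟨Ax, x⟩` is `inner ℂ x (A x)`. -/
def numericalRange {n : ℕ} (A : Matrix (Fin n) (Fin n) ℂ) : Set ℂ :=
  {z | ∃ x : EuclideanSpace ℂ (Fin n), ‖x‖ = 1 ∧ inner ℂ x (Matrix.toEuclideanLin A x) = z}

/-- A non-degenerate ellipse in the complex plane, given by its center, the angle between the real
axis and its first axis, and its two (positive) semi-axes, in no particular order. Circles are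
included. -/
structure Ellipse where
  center : ℂ
  angle : ℝ
  semiAxis₁ : ℝ
  semiAxis₂ : ℝ
  semiAxis₁_pos : 0 < semiAxis₁
  semiAxis₂_pos : 0 < semiAxis₂

/-- The ellipse as a curve: the points `c + e^{iφ} (a₁ cos t + i a₂ sin t)`, `t` real. -/
def Ellipse.curve (E : Ellipse) : Set ℂ :=
  Set.range fun t : ℝ =>
    E.center + Complex.exp (E.angle * Complex.I) *
      ((E.semiAxis₁ * Real.cos t : ℝ) + (E.semiAxis₂ * Real.sin t : ℝ) * Complex.I)

/-- The closed elliptical disk bounded by the ellipse. -/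
def Ellipse.disk (E : Ellipse) : Set ℂ :=
  convexHull ℝ E.curve

/-- A set has bi-elliptical shape if it is the convex hull of two non-degenerate ellipses with
distinct centers, neither of which lies in the elliptical disk bounded by the other one
(otherwise the convex hull would be just an elliptical disk). -/
def IsBiElliptical (S : Set ℂ) : Prop :=
  ∃ E₁ E₂ : Ellipse, E₁.center ≠ E₂.center ∧
    ¬ E₁.curve ⊆ E₂.disk ∧ ¬ E₂.curve ⊆ E₁.disk ∧
    S = convexHull ℝ (E₁.curve ∪ E₂.curve)

/-- The matrix `[[α I, B* + I], [B - I, -α I]]` with `B = [[b₁, b], [0, b₂]]`, `b` real. -/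
def triangularizedMatrix (α b₁ b₂ : ℂ) (b : ℝ) : Matrix (Fin 4) (Fin 4) ℂ :=
  !![α, 0, star b₁ + 1, 0;
     0, α, (b : ℂ), star b₂ + 1;
     b₁ - 1, (b : ℂ), -α, 0;
     0, b₂ - 1, 0, -α]

/-!
By Kippenhahn, the support function of `W(A)` in direction `w` is the largest eigenvalue of
`ℜ (w̄ A)`. For the matrix at hand these eigenvalues are the roots `r` of a quartic
`(r² - P(w))² = (Re w)² D(w)` with quadratic forms `P` and `D`, while the support function
`r` of an ellipse with center `c` satisfies `(r - ⟪w, c⟫)² = Q(w)` with `Q` positive definite.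

If `W(A)` is the convex hull of two ellipses, one of them has `c ≠ 0` and supplies the support
function on an open set of directions. Restricted to `w = 1 + tI`, the form `Q` is irreducible,
so that conic divides the quartic; as the quartic is even in `r`, it consists of two conics
centered at `±c`, and `c` is real. Conversely, such a splitting exhibits the support function as
that of two translates of one ellipse. Comparing coefficients turns the splitting into the stated
conditions.
-/

theorem isCompact_convexHull {E : Type*} [NormedAddCommGroup E] [NormedSpace ℝ E]
    [FiniteDimensional ℝ E] {s : Set E} (hs : IsCompact s) : IsCompact (convexHull ℝ s) := by
  have caratheodory : convexHull ℝ s = ⋃ n ∈ Set.Iic (Module.finrank ℝ E + 1),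
      (fun p : (Fin n → ℝ) × (Fin n → E) => ∑ i, p.1 i • p.2 i) ''
        (stdSimplex ℝ (Fin n) ×ˢ Set.univ.pi fun _ => s) := by
    ext x
    simp only [Set.mem_iUnion, Set.mem_Iic, Set.mem_image, Set.mem_prod, Set.mem_univ_pi,
      Prod.exists, exists_prop]
    constructor
    · intro hx
      obtain ⟨ι, _, z, w, hz, hind, hw, hw1, hwz⟩ := eq_pos_convex_span_of_mem_convexHull hx
      have e := Fintype.equivFin ι
      have hcard : Fintype.card ι ≤ Module.finrank ℝ E + 1 :=
        hind.card_le_finrank_succ.trans (Nat.succ_le_succ (Submodule.finrank_le _))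
      exact ⟨Fintype.card ι, hcard, w ∘ e.symm, z ∘ e.symm,
        ⟨⟨fun i => (hw _).le, (e.symm.sum_comp w).trans hw1⟩, fun i => hz ⟨_, rfl⟩⟩,
        (e.symm.sum_comp fun i => w i • z i).trans hwz⟩
    · rintro ⟨n, -, w, z, ⟨hw, hz⟩, rfl⟩
      exact (convex_convexHull ℝ s).sum_mem (fun i _ => hw.1 i) hw.2
        fun i _ => subset_convexHull ℝ s (hz i)
  rw [caratheodory]
  refine (Set.finite_Iic _).isCompact_biUnion fun n _ => ?_
  exact ((isCompact_stdSimplex ℝ (Fin n)).prod (isCompact_univ_pi fun _ => hs)).image (by fun_prop)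

section SupportFunction

open scoped RealInnerProductSpace

variable {E : Type*} [NormedAddCommGroup E] [InnerProductSpace ℝ E] {K L : Set E} {h k : E → ℝ}

/-- `h` is the support function of `K`, and each of its values is attained on `K`. -/
def HasSupportFunction (K : Set E) (h : E → ℝ) : Prop :=
  ∀ w, IsGreatest ((fun z => ⟪w, z⟫) '' K) (h w)

namespace HasSupportFunction

theorem inner_le (hK : HasSupportFunction K h) (w : E) {z : E} (hz : z ∈ K) : ⟪w, z⟫ ≤ h w :=
  (hK w).2 ⟨z, hz, rfl⟩

theorem exists_inner_eq (hK : HasSupportFunction K h) (w : E) : ∃ z ∈ K, ⟪w, z⟫ = h w :=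
  (hK w).1

theorem convexHull (hK : HasSupportFunction K h) : HasSupportFunction (convexHull ℝ K) h :=
  fun w => ⟨Set.image_mono (subset_convexHull ℝ K) (hK w).1, Set.forall_mem_image.2 fun _ hz =>
    convexHull_min (fun _ => hK.inner_le w)
      (convex_halfSpace_le (innerₛₗ ℝ w).isLinear (h w)) hz⟩

theorem union (hK : HasSupportFunction K h) (hL : HasSupportFunction L k) :
    HasSupportFunction (K ∪ L) (h ⊔ k) := fun w => by
  rw [Set.image_union]
  exact (hK w).union (hL w)

variable [CompleteSpace E]

theorem subset_iff (hK : HasSupportFunction K h) (hL : HasSupportFunction L k)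
    (hconv : Convex ℝ L) (hclosed : IsClosed L) : K ⊆ L ↔ h ≤ k := by
  refine ⟨fun hKL w => ?_, fun hle z hz => ?_⟩
  · obtain ⟨z, hz, hzw⟩ := hK.exists_inner_eq w
    exact hzw ▸ hL.inner_le w (hKL hz)
  · by_contra hzL
    obtain ⟨f, r, hfL, hfz⟩ := geometric_hahn_banach_closed_point hconv hclosed hzL
    set w := (InnerProductSpace.toDual ℝ E).symm f
    have hf (y : E) : ⟪w, y⟫ = f y := InnerProductSpace.toDual_symm_apply
    obtain ⟨y, hy, hyw⟩ := hL.exists_inner_eq w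
    have := calc k w = f y := by rw [← hyw, hf]
      _ < r := hfL y hy
      _ < f z := hfz
      _ ≤ h w := (hf z) ▸ hK.inner_le w hz
    exact this.not_ge (hle w)

theorem eq_of_isClosed (hK : HasSupportFunction K h) (hL : HasSupportFunction L h)
    (hKconv : Convex ℝ K) (hKclosed : IsClosed K) (hLconv : Convex ℝ L) (hLclosed : IsClosed L) :
    K = L :=
  ((hK.subset_iff hL hLconv hLclosed).2 le_rfl).antisymm
    ((hL.subset_iff hK hKconv hKclosed).2 le_rfl)

end HasSupportFunction

end SupportFunction

section ToeplitzHausdorff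

open scoped ComplexConjugate

variable {E : Type*} [NormedAddCommGroup E] [InnerProductSpace ℂ E]

/-- The numerical range of a linear operator on a complex inner product space. -/
def operatorNumericalRange (T : E →ₗ[ℂ] E) : Set ℂ :=
  {z | ∃ x : E, ‖x‖ = 1 ∧ inner ℂ x (T x) = z}

theorem inner_div_sq_norm_mem_operatorNumericalRange (T : E →ₗ[ℂ] E) {x : E} (hx : x ≠ 0) :
    inner ℂ x (T x) / ‖x‖ ^ 2 ∈ operatorNumericalRange T := by
  refine ⟨((‖x‖⁻¹ : ℝ) : ℂ) • x, ?_, ?_⟩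
  · rw [norm_smul, Complex.norm_real, norm_inv, norm_norm,
      inv_mul_cancel₀ (norm_ne_zero_iff.2 hx)]
  · rw [map_smul, inner_smul_left, inner_smul_right, Complex.conj_ofReal, Complex.ofReal_inv]
    field_simp

theorem mem_operatorNumericalRange_smul_add_smul_one_iff (T : E →ₗ[ℂ] E) {a d z : ℂ} (hd : d ≠ 0) :
    a + d * z ∈ operatorNumericalRange T ↔ z ∈ operatorNumericalRange (d⁻¹ • (T - a • 1)) := by
  refine exists_congr fun x => and_congr_right fun hx => ?_
  have : inner ℂ x ((d⁻¹ • (T - a • 1)) x) = d⁻¹ * (inner ℂ x (T x) - a) := by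
    simp [hx]
  rw [this, inv_mul_eq_iff_eq_mul₀ hd, sub_eq_iff_eq_add']

theorem exists_phase_im_eq_zero (p q : ℂ) : ∃ c : ℂ, ‖c‖ = 1 ∧ (conj c * p + c * q).im = 0 := by
  suffices h : ∃ c : ℂ, ‖c‖ = 1 ∧ (conj c * (p - conj q)).im = 0 by
    obtain ⟨c, hc, him⟩ := h
    refine ⟨c, hc, ?_⟩
    rw [mul_sub, ← map_mul, Complex.sub_im, Complex.conj_im, sub_neg_eq_add] at him
    rwa [Complex.add_im]
  refine ⟨Complex.exp (Complex.arg (p - conj q) * Complex.I), Complex.norm_exp_ofReal_mul_I _, ?_⟩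
  have : conj (Complex.exp (Complex.arg (p - conj q) * Complex.I)) * (p - conj q) =
      (‖p - conj q‖ : ℂ) := by
    nth_rewrite 2 [← Complex.norm_mul_exp_arg_mul_I (p - conj q)]
    rw [mul_left_comm, Complex.conj_mul', Complex.norm_exp_ofReal_mul_I]
    simp
  rw [this, Complex.ofReal_im]

theorem smul_add_smul_ne_zero_of_inner_eq {S : E →ₗ[ℂ] E} {x y : E} (hx : x ≠ 0)
    (hSx : inner ℂ x (S x) = 0) (hSy : inner ℂ y (S y) = 1) (α β : ℂ) (hαβ : α + β = 1) :
    α • x + β • y ≠ 0 := by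
  intro h
  have hβy : β • y = -(α • x) := eq_neg_of_add_eq_zero_right h
  have hβ : β = 0 := by
    have : inner ℂ (β • y) (S (β • y)) = 0 := by
      rw [hβy]
      simp [inner_smul_left, inner_smul_right, hSx]
    simpa [inner_smul_left, inner_smul_right, hSy] using this
  have hα : α = 1 := by rwa [hβ, add_zero] at hαβ
  rw [hα, hβ, one_smul, zero_smul, add_zero] at h
  exact hx h

/-- After a rotation of `x` the form of `S` is real along the path from `x` to `y`, and the
intermediate value theorem applies to its Rayleigh quotient. -/
theorem ofReal_mem_operatorNumericalRange {S : E →ₗ[ℂ] E} (h0 : 0 ∈ operatorNumericalRange S)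
    (h1 : 1 ∈ operatorNumericalRange S) {s : ℝ} (hs : s ∈ Set.Icc (0 : ℝ) 1) :
    (s : ℂ) ∈ operatorNumericalRange S := by
  obtain ⟨x₀, hx₀, hSx₀⟩ := h0
  obtain ⟨y, hy, hSy⟩ := h1
  obtain ⟨c, hc, him⟩ := exists_phase_im_eq_zero (inner ℂ x₀ (S y)) (inner ℂ y (S x₀))
  set x := c • x₀ with hx
  have hxn : ‖x‖ = 1 := by rw [hx, norm_smul, hc, hx₀, one_mul]
  have hSx : inner ℂ x (S x) = 0 := by
    rw [hx, map_smul, inner_smul_left, inner_smul_right, hSx₀, mul_zero, mul_zero]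
  obtain ⟨g, hg⟩ : ∃ g : ℝ, inner ℂ x (S y) + inner ℂ y (S x) = g :=
    ⟨_, Complex.ext rfl (by
      rw [hx, map_smul, inner_smul_left, inner_smul_right, him, Complex.ofReal_im])⟩
  set v : ℝ → E := fun t => ((1 - t : ℝ) : ℂ) • x + (t : ℂ) • y with hv
  have hSv (t : ℝ) : inner ℂ (v t) (S (v t)) = ((t ^ 2 + t * (1 - t) * g : ℝ) : ℂ) := by
    simp only [hv, map_add, map_smul, inner_add_left, inner_add_right, inner_smul_left,
      inner_smul_right, hSx, hSy, Complex.conj_ofReal]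
    push_cast
    linear_combination (t * (1 - t) : ℂ) * hg
  have hv0 (t : ℝ) : v t ≠ 0 :=
    smul_add_smul_ne_zero_of_inner_eq (norm_ne_zero_iff.1 (hxn ▸ one_ne_zero)) hSx hSy _ _
      (by push_cast; ring)
  have hcont : Continuous fun t => (t ^ 2 + t * (1 - t) * g) / ‖v t‖ ^ 2 :=
    Continuous.div (by fun_prop) (by fun_prop) fun t => pow_ne_zero 2 (norm_ne_zero_iff.2 (hv0 t))
  obtain ⟨t, -, ht⟩ := intermediate_value_Icc zero_le_one hcont.continuousOn
    (show s ∈ Set.Icc _ _ by simpa [hv, hy] using hs)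
  convert! inner_div_sq_norm_mem_operatorNumericalRange S (hv0 t)
  rw [hSv, ← ht, Complex.ofReal_div, Complex.ofReal_pow]

theorem convex_operatorNumericalRange (T : E →ₗ[ℂ] E) : Convex ℝ (operatorNumericalRange T) := by
  rw [convex_iff_segment_subset]
  intro a ha a' ha'
  rcases eq_or_ne a' a with rfl | hne
  · rwa [segment_same, Set.singleton_subset_iff]
  have hd : a' - a ≠ 0 := sub_ne_zero.2 hne
  rw [segment_eq_image']
  rintro _ ⟨s, hs, rfl⟩
  beta_reduce
  rw [Complex.real_smul, mul_comm, mem_operatorNumericalRange_smul_add_smul_one_iff T hd]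
  refine ofReal_mem_operatorNumericalRange ?_ ?_ hs
  · rwa [← mem_operatorNumericalRange_smul_add_smul_one_iff T hd, mul_zero, add_zero]
  · rwa [← mem_operatorNumericalRange_smul_add_smul_one_iff T hd, mul_one, add_sub_cancel]

end ToeplitzHausdorff

section Kippenhahn

open scoped RealInnerProductSpace ComplexStarModule

variable {n : ℕ} (A : Matrix (Fin n) (Fin n) ℂ)

theorem convex_numericalRange : Convex ℝ (numericalRange A) :=
  convex_operatorNumericalRange A.toEuclideanLin

theorem isCompact_numericalRange : IsCompact (numericalRange A) := by
  have h : numericalRange A = (fun x : EuclideanSpace ℂ (Fin n) =>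
      inner ℂ x (A.toEuclideanLin x)) '' Metric.sphere 0 1 := by
    ext z
    simp [numericalRange]
  have := LinearMap.continuous_of_finiteDimensional A.toEuclideanLin
  rw [h]
  exact (isCompact_sphere _ _).image (by fun_prop)

theorem inner_toEuclideanLin_realPart (w : ℂ) (x : EuclideanSpace ℂ (Fin n)) :
    inner ℂ x (Matrix.toEuclideanLin (ℜ (star w • A) : Matrix (Fin n) (Fin n) ℂ) x) =
      (⟪w, inner ℂ x (A.toEuclideanLin x)⟫ : ℂ) := by
  have hstar : inner ℂ x (Matrix.toEuclideanLin (star A) x) =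
      star (inner ℂ x (A.toEuclideanLin x)) := by
    rw [Matrix.star_eq_conjTranspose, Matrix.toEuclideanLin_conjTranspose_eq_adjoint,
      LinearMap.adjoint_inner_right, ← inner_conj_symm]
    rfl
  rw [realPart_apply_coe, star_smul, star_star, ← Complex.coe_smul]
  simp only [map_smul, map_add, LinearMap.smul_apply, LinearMap.add_apply, inner_smul_right,
    inner_add_right, hstar]
  generalize inner ℂ x (A.toEuclideanLin x) = z
  apply Complex.ext <;> simp [Complex.inner] <;> ring

theorem mem_spectrum_realPart_of_isGreatest {w : ℂ} {M : ℝ}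
    (h : IsGreatest ((fun z => ⟪w, z⟫) '' numericalRange A) M) :
    (M : ℂ) ∈ spectrum ℂ (ℜ (star w • A) : Matrix (Fin n) (Fin n) ℂ) := by
  obtain ⟨⟨_, ⟨x, hx, rfl⟩, hxM⟩, hub⟩ := h
  let T := Matrix.toEuclideanCLM (n := Fin n) (𝕜 := ℂ) (ℜ (star w • A))
  have hT : IsSelfAdjoint T := (ℜ (star w • A)).2.map Matrix.toEuclideanCLM
  have hTform (y : EuclideanSpace ℂ (Fin n)) :
      T.reApplyInnerSelf y = ⟪w, inner ℂ y (A.toEuclideanLin y)⟫ := by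
    rw [ContinuousLinearMap.reApplyInnerSelf, inner_re_symm]
    exact (congrArg Complex.re (inner_toEuclideanLin_realPart A w y)).trans (Complex.ofReal_re _)
  have hmax : IsMaxOn T.reApplyInnerSelf (Metric.sphere 0 ‖x‖) x := isMaxOn_iff.2 fun y hy => by
    rw [hTform, hTform x, show ⟪w, _⟫ = M from hxM]
    exact hub ⟨_, ⟨y, (mem_sphere_zero_iff_norm.1 hy).trans hx, rfl⟩, rfl⟩
  have hM : T.rayleighQuotient x = M := by
    rw [ContinuousLinearMap.rayleighQuotient, hTform, hx, one_pow, div_one, ← hxM]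
  have hvec := hT.hasEigenvector_of_isLocalExtrOn (norm_ne_zero_iff.1 (hx ▸ one_ne_zero))
    (Or.inr hmax.localize)
  have := Module.End.hasEigenvalue_of_hasEigenvector hvec
  rwa [hM, Module.End.hasEigenvalue_iff_mem_spectrum,
    Matrix.coe_toEuclideanCLM_eq_toEuclideanLin, Matrix.spectrum_toLpLin] at this

theorem mem_image_inner_of_mem_spectrum_realPart {w : ℂ} {M : ℝ}
    (h : (M : ℂ) ∈ spectrum ℂ (ℜ (star w • A) : Matrix (Fin n) (Fin n) ℂ)) :
    M ∈ (fun z => ⟪w, z⟫) '' numericalRange A := by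
  rw [← Matrix.spectrum_toLpLin 2, ← Module.End.hasEigenvalue_iff_mem_spectrum] at h
  obtain ⟨x, hx⟩ := h.exists_hasEigenvector
  refine ⟨_, inner_div_sq_norm_mem_operatorNumericalRange _ hx.2, ?_⟩
  have := inner_toEuclideanLin_realPart A w x
  rw [hx.apply_eq_smul, inner_smul_right, inner_self_eq_norm_sq_to_K, mul_comm] at this
  have hx' : ‖x‖ ≠ 0 := norm_ne_zero_iff.2 hx.2
  rw [← Complex.ofReal_pow, div_eq_inv_mul, ← Complex.ofReal_inv, ← Complex.real_smul]
  beta_reduce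
  rw [real_inner_smul_right]
  field_simp
  exact Complex.ofReal_injective (by push_cast; exact this.symm)

theorem isGreatest_inner_numericalRange_iff {w : ℂ} {M : ℝ} :
    IsGreatest ((fun z => ⟪w, z⟫) '' numericalRange A) M ↔
      IsGreatest {r : ℝ | (r : ℂ) ∈ spectrum ℂ (ℜ (star w • A) : Matrix (Fin n) (Fin n) ℂ)} M := by
  refine ⟨fun h => ⟨mem_spectrum_realPart_of_isGreatest A h, fun r hr =>
    h.2 (mem_image_inner_of_mem_spectrum_realPart A hr)⟩, fun h => ?_⟩
  have hM := mem_image_inner_of_mem_spectrum_realPart A h.1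
  have hcompact : IsCompact ((fun z => ⟪w, z⟫) '' numericalRange A) :=
    (isCompact_numericalRange A).image (by fun_prop)
  obtain ⟨M', hM'⟩ := hcompact.exists_isGreatest ⟨M, hM⟩
  exact ⟨hM, fun r hr =>
    (hM'.2 hr).trans (h.2 (mem_spectrum_realPart_of_isGreatest A hM'))⟩

end Kippenhahn

section QuadraticForm

open QuadraticMap

theorem quadraticForm_apply_eq (Q : QuadraticForm ℝ ℂ) (w : ℂ) :
    Q w = Q 1 * w.re ^ 2 + polar Q 1 Complex.I * (w.re * w.im) + Q Complex.I * w.im ^ 2 := by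
  have hw : w = w.re • (1 : ℂ) + w.im • Complex.I := by simp [Complex.re_add_im]
  conv_lhs => rw [hw]
  rw [QuadraticMap.map_add Q, QuadraticMap.map_smul, QuadraticMap.map_smul,
    QuadraticMap.polar_smul_left, QuadraticMap.polar_smul_right]
  simp only [smul_eq_mul]
  ring

theorem polar_sq_lt_of_posDef {Q : QuadraticForm ℝ ℂ} (hQ : Q.PosDef) :
    polar Q 1 Complex.I ^ 2 < 4 * Q 1 * Q Complex.I := by
  have h1 : 0 < Q 1 := hQ 1 one_ne_zero
  have h := hQ ⟨-polar Q 1 Complex.I, 2 * Q 1⟩ fun h => by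
    have := congrArg Complex.im h
    simp [h1.ne'] at this
  rw [quadraticForm_apply_eq] at h
  nlinarith

/-- The quadratic form `p (Re w)² + 2 q Re w Im w + r (Im w)²` on the complex plane. -/
def planeForm (p q r : ℝ) : QuadraticForm ℝ ℂ :=
  p • linMulLin Complex.reLm Complex.reLm + (2 * q) • linMulLin Complex.reLm Complex.imLm +
    r • linMulLin Complex.imLm Complex.imLm

theorem planeForm_apply (p q r : ℝ) (w : ℂ) :
    planeForm p q r w = p * w.re ^ 2 + 2 * q * (w.re * w.im) + r * w.im ^ 2 := by
  simp [planeForm, _root_.sq]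

theorem posDef_planeForm_iff {p q r : ℝ} : (planeForm p q r).PosDef ↔ 0 < p ∧ q ^ 2 < p * r := by
  constructor
  · intro h
    have hpolar : QuadraticMap.polar (planeForm p q r) 1 Complex.I = 2 * q := by
      simp only [QuadraticMap.polar, planeForm_apply, Complex.add_re, Complex.add_im,
        Complex.one_re, Complex.one_im, Complex.I_re, Complex.I_im]
      ring
    have hlt := polar_sq_lt_of_posDef h
    have h₁ : planeForm p q r 1 = p := by simp [planeForm_apply]
    have hI : planeForm p q r Complex.I = r := by simp [planeForm_apply]
    rw [hpolar, h₁, hI] at hlt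
    exact ⟨h₁ ▸ h 1 one_ne_zero, by linarith⟩
  · rintro ⟨hp, hlt⟩ w hw
    have hsq : p * planeForm p q r w =
        (p * w.re + q * w.im) ^ 2 + (p * r - q ^ 2) * w.im ^ 2 := by
      rw [planeForm_apply]
      ring
    refine pos_of_mul_pos_right ?_ hp.le
    rw [hsq]
    rcases eq_or_ne w.im 0 with him | him
    · have hre : w.re ≠ 0 := fun hre => hw (Complex.ext hre him)
      rw [him, mul_zero, add_zero, zero_pow two_ne_zero, mul_zero, add_zero]
      positivity
    · have := sub_pos.2 hlt
      positivity

end QuadraticForm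

section Ellipse

open scoped RealInnerProductSpace

theorem isGreatest_range_inner_exp_mul_I (z : ℂ) :
    IsGreatest (Set.range fun t : ℝ => ⟪z, Complex.exp (t * Complex.I)⟫) ‖z‖ := by
  constructor
  · refine ⟨z.arg, ?_⟩
    nth_rewrite 1 [← Complex.norm_mul_exp_arg_mul_I z]
    beta_reduce
    rw [← Complex.real_smul, real_inner_smul_left, real_inner_self_eq_norm_sq,
      Complex.norm_exp_ofReal_mul_I, one_pow, mul_one]
  · rintro _ ⟨t, rfl⟩
    simpa [Complex.norm_exp_ofReal_mul_I] using real_inner_le_norm z (Complex.exp (t * Complex.I))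

theorem inner_sq_add_inner_mul_I_sq (w e : ℂ) :
    ⟪w, e⟫ ^ 2 + ⟪w, e * Complex.I⟫ ^ 2 = (‖w‖ * ‖e‖) ^ 2 := by
  rw [mul_pow, Complex.sq_norm, Complex.sq_norm, Complex.normSq_apply, Complex.normSq_apply]
  simp only [Complex.inner, Complex.mul_re, Complex.mul_im, Complex.conj_re, Complex.conj_im,
    Complex.I_re, Complex.I_im]
  ring

theorem inner_sq_sub_inner_mul_I_sq (w e : ℂ) :
    ⟪w, e⟫ ^ 2 - ⟪w, e * Complex.I⟫ ^ 2 = ⟪e ^ 2, w ^ 2⟫ := by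
  simp only [Complex.inner, pow_two, Complex.mul_re, Complex.mul_im, Complex.conj_re,
    Complex.conj_im, Complex.I_re, Complex.I_im]
  ring

theorem quadraticForm_apply_eq_add_inner (Q : QuadraticForm ℝ ℂ) (w : ℂ) :
    Q w = (Q 1 + Q Complex.I) / 2 * ‖w‖ ^ 2 +
      ⟪(⟨(Q 1 - Q Complex.I) / 2, QuadraticMap.polar Q 1 Complex.I / 2⟩ : ℂ), w ^ 2⟫ := by
  rw [quadraticForm_apply_eq, Complex.sq_norm, Complex.normSq_apply, Complex.inner]
  simp only [pow_two, Complex.mul_re, Complex.mul_im, Complex.conj_re, Complex.conj_im]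
  ring

namespace Ellipse

variable (E F : Ellipse)

/-- The unit vector along the first axis of the ellipse. -/
noncomputable def axis : ℂ :=
  Complex.exp (E.angle * Complex.I)

/-- The square of the support function of the ellipse translated to the origin. -/
noncomputable def supportForm : QuadraticForm ℝ ℂ :=
  E.semiAxis₁ ^ 2 • QuadraticMap.linMulLin (innerₛₗ ℝ E.axis) (innerₛₗ ℝ E.axis) +
    E.semiAxis₂ ^ 2 • QuadraticMap.linMulLin (innerₛₗ ℝ (E.axis * Complex.I))
      (innerₛₗ ℝ (E.axis * Complex.I))

/-- The support function of the ellipse. -/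
noncomputable def support (w : ℂ) : ℝ :=
  ⟪w, E.center⟫ + √(E.supportForm w)

theorem supportForm_apply (w : ℂ) : E.supportForm w =
    (E.semiAxis₁ * ⟪w, E.axis⟫) ^ 2 + (E.semiAxis₂ * ⟪w, E.axis * Complex.I⟫) ^ 2 := by
  simp only [supportForm, add_apply, smul_apply,
    QuadraticMap.linMulLin_apply, innerₛₗ_apply_apply, smul_eq_mul, real_inner_comm]
  ring

theorem norm_axis : ‖E.axis‖ = 1 :=
  Complex.norm_exp_ofReal_mul_I E.angle

theorem posDef_supportForm : E.supportForm.PosDef := by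
  intro w hw
  have hpyth := inner_sq_add_inner_mul_I_sq w E.axis
  rw [norm_axis, mul_one] at hpyth
  rw [supportForm_apply]
  refine (by positivity : (0 : ℝ) ≤ _).lt_of_ne' fun h => ?_
  obtain ⟨h₁, h₂⟩ := (add_eq_zero_iff_of_nonneg (sq_nonneg _) (sq_nonneg _)).1 h
  rw [pow_eq_zero_iff two_ne_zero, mul_eq_zero_iff_left E.semiAxis₁_pos.ne'] at h₁
  rw [pow_eq_zero_iff two_ne_zero, mul_eq_zero_iff_left E.semiAxis₂_pos.ne'] at h₂
  rw [h₁, h₂] at hpyth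
  exact hw (norm_eq_zero.1 (pow_eq_zero_iff two_ne_zero |>.1 (by linarith)))

theorem hasSupportFunction_curve : HasSupportFunction E.curve E.support := by
  intro w
  set z : ℂ := ⟨E.semiAxis₁ * ⟪w, E.axis⟫, E.semiAxis₂ * ⟪w, E.axis * Complex.I⟫⟩ with hz
  have hnorm : ‖z‖ = √(E.supportForm w) := by
    rw [supportForm_apply, Complex.norm_eq_sqrt_sq_add_sq]
  have hinner (t : ℝ) : ⟪w, E.center + E.axis * ((E.semiAxis₁ * Real.cos t : ℝ) +
      (E.semiAxis₂ * Real.sin t : ℝ) * Complex.I)⟫ =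
      ⟪w, E.center⟫ + ⟪z, Complex.exp (t * Complex.I)⟫ := by
    rw [mul_add, mul_left_comm, mul_comm E.axis, ← Complex.real_smul, ← Complex.real_smul,
      inner_add_right, inner_add_right, real_inner_smul_right, real_inner_smul_right]
    rw [Complex.inner z, Complex.mul_re, Complex.conj_re, Complex.conj_im,
      Complex.exp_ofReal_mul_I_re, Complex.exp_ofReal_mul_I_im, hz]
    ring
  have himage : (fun y => ⟪w, y⟫) '' E.curve =
      (⟪w, E.center⟫ + ·) '' Set.range fun t : ℝ => ⟪z, Complex.exp (t * Complex.I)⟫ := by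
    rw [curve, ← Set.range_comp, ← Set.range_comp]
    exact congrArg Set.range (funext hinner)
  rw [himage, support, ← hnorm]
  exact (add_right_strictMono.monotone).map_isGreatest (isGreatest_range_inner_exp_mul_I z)

theorem hasSupportFunction_disk : HasSupportFunction E.disk E.support :=
  E.hasSupportFunction_curve.convexHull

theorem isCompact_curve : IsCompact E.curve := by
  refine Function.Periodic.compact_of_continuous (c := 2 * Real.pi) ?_ Real.two_pi_pos.ne'
    (by fun_prop)
  intro t
  simp

theorem continuous_support : Continuous E.support := by
  unfold support
  simp only [supportForm_apply]
  fun_prop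

variable {E F} in
theorem curve_subset_disk_iff : E.curve ⊆ F.disk ↔ E.support ≤ F.support :=
  E.hasSupportFunction_curve.subset_iff F.hasSupportFunction_disk (convex_convexHull ℝ _)
    (isCompact_convexHull F.isCompact_curve).isClosed

theorem supportForm_apply_eq_add_inner (w : ℂ) : E.supportForm w =
    (E.semiAxis₁ ^ 2 + E.semiAxis₂ ^ 2) / 2 * ‖w‖ ^ 2 +
      (E.semiAxis₁ ^ 2 - E.semiAxis₂ ^ 2) / 2 * ⟪E.axis ^ 2, w ^ 2⟫ := by
  have hadd := inner_sq_add_inner_mul_I_sq w E.axis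
  rw [norm_axis, mul_one] at hadd
  rw [supportForm_apply, ← hadd, ← inner_sq_sub_inner_mul_I_sq]
  ring

theorem exists_supportForm_eq (c : ℂ) {Q : QuadraticForm ℝ ℂ} (hQ : Q.PosDef) :
    ∃ E : Ellipse, E.center = c ∧ E.supportForm = Q := by
  set p := Q 1
  set r := Q Complex.I
  set s := QuadraticMap.polar Q 1 Complex.I
  set ζ : ℂ := ⟨(p - r) / 2, s / 2⟩
  have hp : 0 < p := hQ 1 one_ne_zero
  have hr : 0 < r := hQ Complex.I Complex.I_ne_zero
  have hζ_lt : ‖ζ‖ < (p + r) / 2 := by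
    rw [Complex.norm_eq_sqrt_sq_add_sq, Real.sqrt_lt' (by linarith)]
    change ((p - r) / 2) ^ 2 + (s / 2) ^ 2 < _
    linarith [polar_sq_lt_of_posDef hQ]
  let E : Ellipse :=
    { center := c
      angle := ζ.arg / 2
      semiAxis₁ := √((p + r) / 2 + ‖ζ‖)
      semiAxis₂ := √((p + r) / 2 - ‖ζ‖)
      semiAxis₁_pos := Real.sqrt_pos.2 (by positivity)
      semiAxis₂_pos := Real.sqrt_pos.2 (by linarith) }
  have haxis_sq : ‖ζ‖ * E.axis ^ 2 = ζ := by
    nth_rewrite 2 [← Complex.norm_mul_exp_arg_mul_I ζ]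
    rw [axis, ← Complex.exp_nat_mul]
    push_cast [E]
    congr 2
    ring
  refine ⟨E, rfl, QuadraticMap.ext fun w => ?_⟩
  calc E.supportForm w = (p + r) / 2 * ‖w‖ ^ 2 + ‖ζ‖ * ⟪E.axis ^ 2, w ^ 2⟫ := by
        rw [supportForm_apply_eq_add_inner, Real.sq_sqrt (by positivity),
          Real.sq_sqrt (by linarith)]
        ring
    _ = (p + r) / 2 * ‖w‖ ^ 2 + ⟪ζ, w ^ 2⟫ := by
        rw [← real_inner_smul_left, Complex.real_smul, haxis_sq]
    _ = Q w := by rw [quadraticForm_apply_eq_add_inner]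

end Ellipse

end Ellipse

section Polynomial

open Polynomial

theorem eq_zero_of_sq_eq_mul_sq {R : Type*} [CommRing R] [IsDomain R] [WfDvdMonoid R]
    {p a b : R} (hp : Prime p) (h : a ^ 2 = p * b ^ 2) : b = 0 := by
  by_contra hb
  have hpb : p * b ^ 2 ≠ 0 := mul_ne_zero hp.ne_zero (pow_ne_zero 2 hb)
  have ha : a ≠ 0 := by
    rintro rfl
    exact hpb (by rw [← h, zero_pow two_ne_zero])
  have hfa := FiniteMultiplicity.of_prime_left hp ha
  have hfb := FiniteMultiplicity.of_prime_left hp hb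
  have := congrArg (multiplicity p) h
  rw [hfa.multiplicity_pow hp, multiplicity_mul hp (.of_prime_left hp hpb),
    hfb.multiplicity_pow hp, multiplicity_self] at this
  lia

theorem eq_sq_add_and_eq_of_infinite {K : Type*} [Field K] [NeZero (4 : K)] {l q P D : K[X]}
    (hq : Irreducible q) (hl : l ≠ 0) {S : Set K} (hS : S.Infinite)
    (h : ∀ t ∈ S, ∃ g, g ^ 2 = q.eval t ∧ ((l.eval t + g) ^ 2 - P.eval t) ^ 2 = D.eval t) :
    P = l ^ 2 + q ∧ D = 4 * l ^ 2 * q := by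
  set F := (l ^ 2 + q - P) ^ 2 + 4 * l ^ 2 * q - D with hF
  set G := 4 * l * (l ^ 2 + q - P) with hG
  have hFG : F ^ 2 = q * G ^ 2 := by
    refine eq_of_infinite_eval_eq _ _ (hS.mono fun t ht => ?_)
    obtain ⟨g, hgq, hg⟩ := h t ht
    have : F.eval t = -(g * G.eval t) := by
      simp only [hF, hG, eval_sub, eval_add, eval_mul, eval_pow, eval_ofNat, ← hgq, ← hg]
      ring
    simp only [Set.mem_ofPred_eq, eval_pow, eval_mul, this, ← hgq]
    ring
  have hG0 : G = 0 := eq_zero_of_sq_eq_mul_sq hq.prime hFG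
  have hF0 : F = 0 := by rwa [hG0, zero_pow two_ne_zero, mul_zero, sq_eq_zero_iff] at hFG
  have h4 : (4 : K[X]) ≠ 0 := by
    rw [← C_ofNat 4, C_ne_zero]
    exact four_ne_zero
  have hP : l ^ 2 + q - P = 0 := (mul_eq_zero.1 hG0).resolve_left (mul_ne_zero h4 hl)
  refine ⟨(sub_eq_zero.1 hP).symm, ?_⟩
  rw [hF, hP] at hF0
  linear_combination -hF0

/-- The restriction of a quadratic form on `ℂ` to the line `1 + tI`. -/
noncomputable def slicePolynomial (Q : QuadraticForm ℝ ℂ) : ℝ[X] :=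
  C (Q Complex.I) * X ^ 2 + C (QuadraticMap.polar Q 1 Complex.I) * X + C (Q 1)

theorem eval_slicePolynomial (Q : QuadraticForm ℝ ℂ) (t : ℝ) :
    (slicePolynomial Q).eval t = Q (1 + t * Complex.I) := by
  rw [quadraticForm_apply_eq]
  simp only [slicePolynomial, eval_add, eval_mul, eval_C, eval_pow, eval_X, Complex.add_re,
    Complex.add_im, Complex.one_re, Complex.one_im, Complex.mul_re, Complex.mul_im,
    Complex.ofReal_re, Complex.ofReal_im, Complex.I_re, Complex.I_im]
  ring

theorem natDegree_slicePolynomial_le (Q : QuadraticForm ℝ ℂ) : (slicePolynomial Q).natDegree ≤ 2 :=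
  natDegree_quadratic_le

theorem natDegree_slicePolynomial {Q : QuadraticForm ℝ ℂ} (hQ : Q.PosDef) :
    (slicePolynomial Q).natDegree = 2 :=
  natDegree_quadratic (hQ _ Complex.I_ne_zero).ne'

theorem irreducible_slicePolynomial {Q : QuadraticForm ℝ ℂ} (hQ : Q.PosDef) :
    Irreducible (slicePolynomial Q) := by
  refine irreducible_of_degree_le_three_of_not_isRoot (by simp [natDegree_slicePolynomial hQ])
    fun t ht => ?_
  rw [IsRoot, eval_slicePolynomial] at ht
  refine (hQ (1 + t * Complex.I) fun h => ?_).ne' ht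
  simpa using congrArg Complex.re h

theorem quadraticForm_eq_of_slice {Q R : QuadraticForm ℝ ℂ}
    (h : ∀ t : ℝ, Q (1 + t * Complex.I) = R (1 + t * Complex.I)) : Q = R := by
  have hpoly : slicePolynomial Q = slicePolynomial R :=
    Polynomial.funext fun t => by rw [eval_slicePolynomial, eval_slicePolynomial, h]
  have hcoeff (S : QuadraticForm ℝ ℂ) (w : ℂ) : S w = (slicePolynomial S).coeff 0 * w.re ^ 2 +
      (slicePolynomial S).coeff 1 * (w.re * w.im) + (slicePolynomial S).coeff 2 * w.im ^ 2 := by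
    rw [quadraticForm_apply_eq]
    simp [slicePolynomial]
  ext w
  rw [hcoeff, hcoeff R, hpoly]

end Polynomial

theorem infinite_setOf_smul_mem {U : Set ℂ} (hU : IsOpen U) (hne : U.Nonempty) :
    {t : ℝ | ∃ c : ℝ, c ≠ 0 ∧ c • (1 + t * Complex.I) ∈ U}.Infinite := by
  have hdense : Dense {w : ℂ | w.re ≠ 0} :=
    (dense_compl_singleton (0 : ℝ)).preimage Complex.isOpenMap_re
  obtain ⟨w, hw, hwU⟩ := hdense.exists_mem_open hU hne
  have hslope : w.re • (1 + (w.im / w.re : ℝ) * Complex.I) = w := by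
    apply Complex.ext <;> simp [mul_div_cancel₀ _ hw]
  refine infinite_of_mem_nhds (w.im / w.re) ?_
  have hcont : Continuous fun t : ℝ => w.re • (1 + t * Complex.I) := by fun_prop
  filter_upwards [hcont.continuousAt.preimage_mem_nhds (hU.mem_nhds (by rwa [hslope]))] with t ht
  exact ⟨w.re, hw, ht⟩

section Criterion

open scoped RealInnerProductSpace ComplexStarModule
open Polynomial

variable {n : ℕ} {A : Matrix (Fin n) (Fin n) ℂ} {P D : QuadraticForm ℝ ℂ}

/-- The eigenvalues `r` of `ℜ (star w • A)`, which describe the lines tangent to the Kippenhahn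
curve of `A`, are the real roots of `(r² - P w)² = (Re w)² D w`. -/
def HasKippenhahnQuartic (A : Matrix (Fin n) (Fin n) ℂ) (P D : QuadraticForm ℝ ℂ) : Prop :=
  ∀ (w : ℂ) (r : ℝ), (r : ℂ) ∈ spectrum ℂ (ℜ (star w • A) : Matrix (Fin n) (Fin n) ℂ) ↔
    (r ^ 2 - P w) ^ 2 = w.re ^ 2 * D w

/-- The curve `(r² - P)² = (Re w)² D` is the union of the conics `(r - k Re w)² = Q` and
`(r + k Re w)² = Q`, which are dual to two ellipses with centers `±k`. -/
def SplitsIntoConics (P D : QuadraticForm ℝ ℂ) : Prop :=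
  ∃ k : ℝ, k ≠ 0 ∧ ∃ Q : QuadraticForm ℝ ℂ, Q.PosDef ∧ P = planeForm (k ^ 2) 0 0 + Q ∧
    D = (4 * k ^ 2) • Q

theorem Ellipse.support_smul (E : Ellipse) {c : ℝ} (hc : c ≠ 0) (v : ℂ) :
    ∃ g, g ^ 2 = E.supportForm v ∧ E.support (c • v) = c * (⟪v, E.center⟫ + g) := by
  refine ⟨|c| * √(E.supportForm v) / c, ?_, ?_⟩
  · rw [div_pow, mul_pow, sq_abs, Real.sq_sqrt (E.posDef_supportForm.nonneg v)]
    field_simp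
  · rw [Ellipse.support, real_inner_smul_left, QuadraticMap.map_smul, smul_eq_mul,
      Real.sqrt_mul (mul_self_nonneg c), Real.sqrt_mul_self_eq_abs]
    field_simp

/-- The restriction of the linear functional `⟪·, center⟫` to the line `1 + tI`. -/
noncomputable def Ellipse.centerPolynomial (E : Ellipse) : ℝ[X] :=
  C E.center.im * X + C E.center.re

theorem Ellipse.eval_centerPolynomial (E : Ellipse) (t : ℝ) :
    E.centerPolynomial.eval t = ⟪1 + t * Complex.I, E.center⟫ := by
  simp only [centerPolynomial, eval_add, eval_mul, eval_C, eval_X, Complex.inner, Complex.mul_re,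
    Complex.conj_re, Complex.conj_im, Complex.add_re, Complex.add_im, Complex.one_re,
    Complex.one_im, Complex.mul_im, Complex.ofReal_re, Complex.ofReal_im, Complex.I_re,
    Complex.I_im]
  ring

theorem Ellipse.centerPolynomial_ne_zero {E : Ellipse} (hE : E.center ≠ 0) :
    E.centerPolynomial ≠ 0 := fun h =>
  hE <| Complex.ext (by simpa [centerPolynomial] using congrArg (coeff · 0) h)
    (by simpa [centerPolynomial] using congrArg (coeff · 1) h)

theorem Ellipse.slicePolynomial_eq_of_support_root (E : Ellipse) (hE : E.center ≠ 0) {U : Set ℂ}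
    (hU : IsOpen U) (hne : U.Nonempty)
    (h : ∀ w ∈ U, (E.support w ^ 2 - P w) ^ 2 = w.re ^ 2 * D w) :
    slicePolynomial P = E.centerPolynomial ^ 2 + slicePolynomial E.supportForm ∧
      slicePolynomial D = 4 * E.centerPolynomial ^ 2 * slicePolynomial E.supportForm := by
  refine eq_sq_add_and_eq_of_infinite (irreducible_slicePolynomial E.posDef_supportForm)
    (centerPolynomial_ne_zero hE) (infinite_setOf_smul_mem hU hne) ?_
  rintro t ⟨c, hc, hcU⟩
  obtain ⟨g, hg, hsupp⟩ := E.support_smul hc (1 + t * Complex.I)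
  refine ⟨g, by rw [hg, eval_slicePolynomial], ?_⟩
  have hroot := h _ hcU
  have hre : (c • (1 + t * Complex.I)).re = c := by simp
  rw [hsupp, QuadraticMap.map_smul, QuadraticMap.map_smul, smul_eq_mul, smul_eq_mul, hre] at hroot
  rw [eval_centerPolynomial, eval_slicePolynomial, eval_slicePolynomial]
  exact mul_left_cancel₀ (pow_ne_zero 4 hc) (by linear_combination hroot)

theorem Ellipse.center_im_eq_zero {E : Ellipse}
    (h : slicePolynomial D = 4 * E.centerPolynomial ^ 2 * slicePolynomial E.supportForm) :
    E.center.im = 0 := by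
  by_contra him
  have hl : E.centerPolynomial.natDegree = 1 := natDegree_linear him
  have hl0 : E.centerPolynomial ≠ 0 := ne_zero_of_natDegree_gt (hl.symm ▸ zero_lt_one)
  have hdeg := natDegree_slicePolynomial_le D
  rw [h, mul_assoc, ← C_ofNat 4, natDegree_C_mul four_ne_zero, natDegree_mul (pow_ne_zero 2 hl0)
    (irreducible_slicePolynomial E.posDef_supportForm).ne_zero, natDegree_pow, hl,
    natDegree_slicePolynomial E.posDef_supportForm] at hdeg
  lia

theorem Ellipse.forms_eq_of_support_root (E : Ellipse) (hE : E.center ≠ 0) {U : Set ℂ}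
    (hU : IsOpen U) (hne : U.Nonempty)
    (h : ∀ w ∈ U, (E.support w ^ 2 - P w) ^ 2 = w.re ^ 2 * D w) :
    E.center.re ≠ 0 ∧ P = planeForm (E.center.re ^ 2) 0 0 + E.supportForm ∧
      D = (4 * E.center.re ^ 2) • E.supportForm := by
  obtain ⟨hP, hD⟩ := E.slicePolynomial_eq_of_support_root hE hU hne h
  have him : E.center.im = 0 := center_im_eq_zero hD
  have hcenter : E.centerPolynomial = C E.center.re := by simp [centerPolynomial, him]
  rw [hcenter] at hP hD
  refine ⟨fun hre => hE (Complex.ext hre him), quadraticForm_eq_of_slice fun t => ?_,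
    quadraticForm_eq_of_slice fun t => ?_⟩
  · rw [← eval_slicePolynomial, hP, add_apply, planeForm_apply]
    simp [eval_slicePolynomial]
  · rw [← eval_slicePolynomial, hD]
    simp [eval_slicePolynomial]

theorem Ellipse.not_curve_subset_disk {E F : Ellipse} (h : E.supportForm = F.supportForm)
    (hc : E.center ≠ F.center) : ¬ E.curve ⊆ F.disk := by
  rw [Ellipse.curve_subset_disk_iff]
  intro hle
  have := hle (E.center - F.center)
  rw [Ellipse.support, Ellipse.support, h, add_le_add_iff_right, ← sub_nonpos, ← inner_sub_right,
    real_inner_self_nonpos, sub_eq_zero] at this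
  exact hc this

theorem isGreatest_abs_add (a : ℝ) {g : ℝ} (hg : 0 ≤ g) :
    IsGreatest {r : ℝ | (r ^ 2 - (a ^ 2 + g ^ 2)) ^ 2 = (2 * a * g) ^ 2} (|a| + g) := by
  constructor
  · rw [Set.mem_ofPred_eq, add_sq, sq_abs, ← sq_abs (2 * a * g), abs_mul, abs_mul, abs_two,
      abs_of_nonneg hg]
    ring
  · intro r hr
    have := (le_abs_self _).trans_eq ((sq_eq_sq_iff_abs_eq_abs _ _).1 hr)
    rw [abs_mul, abs_mul, abs_two, abs_of_nonneg hg] at this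
    refine abs_le_of_sq_le_sq' ?_ (by positivity) |>.2
    rw [add_sq, sq_abs]
    linarith

theorem HasKippenhahnQuartic.splitsIntoConics (hA : HasKippenhahnQuartic A P D)
    (h : IsBiElliptical (numericalRange A)) : SplitsIntoConics P D := by
  obtain ⟨E, F, hne, hEF, hFE, hW⟩ := h
  have hsupp : HasSupportFunction (numericalRange A) (E.support ⊔ F.support) :=
    hW ▸ (E.hasSupportFunction_curve.union F.hasSupportFunction_curve).convexHull
  have hroot (w : ℂ) : ((E.support ⊔ F.support) w ^ 2 - P w) ^ 2 = w.re ^ 2 * D w :=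
    (hA w _).1 ((isGreatest_inner_numericalRange_iff A).1 (hsupp w)).1
  simp only [Ellipse.curve_subset_disk_iff, Pi.le_def, not_forall, not_le] at hEF hFE
  rcases ne_or_eq E.center 0 with hE | hE
  · obtain ⟨hk, hP, hD⟩ := E.forms_eq_of_support_root hE
      (isOpen_lt F.continuous_support E.continuous_support) hEF fun w (hw : _ < _) => by
        rw [← hroot w, Pi.sup_apply, sup_of_le_left hw.le]
    exact ⟨_, hk, _, E.posDef_supportForm, hP, hD⟩
  · obtain ⟨hk, hP, hD⟩ := F.forms_eq_of_support_root (fun hF => hne (hE.trans hF.symm))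
      (isOpen_lt E.continuous_support F.continuous_support) hFE fun w (hw : _ < _) => by
        rw [← hroot w, Pi.sup_apply, sup_of_le_right hw.le]
    exact ⟨_, hk, _, F.posDef_supportForm, hP, hD⟩

theorem HasKippenhahnQuartic.isBiElliptical_iff (hA : HasKippenhahnQuartic A P D) :
    IsBiElliptical (numericalRange A) ↔ SplitsIntoConics P D := by
  refine ⟨hA.splitsIntoConics, fun ⟨k, hk, Q, hQ, hP, hD⟩ => ?_⟩
  obtain ⟨E, hEc, hEQ⟩ := Ellipse.exists_supportForm_eq k hQ
  obtain ⟨F, hFc, hFQ⟩ := Ellipse.exists_supportForm_eq (-k) hQ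
  have hne : E.center ≠ F.center := by
    rw [hEc, hFc, Ne, self_eq_neg]
    exact_mod_cast hk
  have hEFQ : E.supportForm = F.supportForm := hEQ.trans hFQ.symm
  refine ⟨E, F, hne, Ellipse.not_curve_subset_disk hEFQ hne,
    Ellipse.not_curve_subset_disk hEFQ.symm hne.symm, ?_⟩
  have hmax (w : ℂ) : (E.support ⊔ F.support) w = |k * w.re| + √(Q w) := by
    simp [Ellipse.support, hEc, hFc, hEQ, hFQ, Complex.inner, max_add_add_right, abs]
  have hW : HasSupportFunction (numericalRange A) (E.support ⊔ F.support) := fun w => by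
    rw [isGreatest_inner_numericalRange_iff, hmax]
    convert! isGreatest_abs_add (k * w.re) (Real.sqrt_nonneg (Q w)) using 3
    rename_i r
    rw [hA, hP, hD, Real.sq_sqrt (hQ.nonneg w), mul_pow (2 * (k * w.re)),
      Real.sq_sqrt (hQ.nonneg w), add_apply, smul_apply, planeForm_apply, smul_eq_mul]
    ring_nf
  exact hW.eq_of_isClosed (E.hasSupportFunction_curve.union F.hasSupportFunction_curve).convexHull
    (convex_numericalRange A) (isCompact_numericalRange A).isClosed (convex_convexHull ℝ _)
    (isCompact_convexHull (E.isCompact_curve.union F.isCompact_curve)).isClosed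

end Criterion

section TriangularizedMatrix

open scoped ComplexStarModule ComplexConjugate

theorem splitsIntoConics_iff {p q p' q' r' : ℝ} :
    SplitsIntoConics (planeForm p q 1) (planeForm p' q' r') ↔
      (planeForm p' q' r').PosDef ∧ q' = r' * q ∧ 4 * p' = r' * (4 * p - r') := by
  constructor
  · rintro ⟨k, hk, Q, hQ, hP, hD⟩
    have hP' (w : ℂ) := DFunLike.congr_fun hP w
    have hD' (w : ℂ) := DFunLike.congr_fun hD w
    simp only [add_apply, smul_apply, planeForm_apply, smul_eq_mul] at hP' hD'
    have hP₁ : p = k ^ 2 + Q 1 := by simpa using hP' 1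
    have hPI : 1 = Q Complex.I := by simpa using hP' Complex.I
    have hPsum : p + 2 * q + 1 = k ^ 2 + Q (1 + Complex.I) := by simpa using hP' (1 + Complex.I)
    have hD₁ : p' = 4 * k ^ 2 * Q 1 := by simpa using hD' 1
    have hDI : r' = 4 * k ^ 2 * Q Complex.I := by simpa using hD' Complex.I
    have hDsum : p' + 2 * q' + r' = 4 * k ^ 2 * Q (1 + Complex.I) := by
      simpa using hD' (1 + Complex.I)
    rw [← hPI, mul_one] at hDI
    refine ⟨hD ▸ hQ.smul (by positivity), ?_, ?_⟩
    · linear_combination (1 / 2) * hDsum - (1 / 2) * hD₁ - (1 / 2) * hDI - q * hDI -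
        2 * k ^ 2 * hPsum + 2 * k ^ 2 * hP₁
    · linear_combination 4 * hD₁ - 16 * k ^ 2 * hP₁ + (r' - 4 * p + 4 * k ^ 2) * hDI
  · rintro ⟨hD, hq, hp⟩
    have hr : 0 < r' := by simpa [planeForm_apply] using hD Complex.I Complex.I_ne_zero
    have hk : (√r' / 2) ^ 2 = r' / 4 := by
      rw [div_pow, Real.sq_sqrt hr.le]
      norm_num
    refine ⟨√r' / 2, by positivity, r'⁻¹ • planeForm p' q' r', hD.smul (by positivity), ?_, ?_⟩
    · ext w
      rw [hk, add_apply, smul_apply, smul_eq_mul, planeForm_apply, planeForm_apply, planeForm_apply,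
        hq]
      field_simp
      linear_combination -w.re ^ 2 * hp
    · rw [hk, smul_smul, mul_div_cancel₀ r' four_ne_zero, mul_inv_cancel₀ hr.ne', one_smul]

theorem det_fin_four_scalar_triangular_blocks {R : Type*} [CommRing R] (a d x y z x' y' z' : R) :
    Matrix.det !![a, 0, x, 0; 0, a, y, z; x', y', d, 0; 0, z', 0, d] =
      (a * d) ^ 2 - a * d * (x * x' + y * y' + z * z') + x * x' * (z * z') := by
  simp [Matrix.det_succ_row_zero, Fin.sum_univ_succ, Fin.succAbove]
  ring

variable (u : ℝ) (b₁ b₂ : ℂ) (b : ℝ)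

/-- The mean `P` of the squared eigenvalues of `ℜ (star w • A)` for the triangularized
matrix `A`. -/
noncomputable def sqMeanForm : QuadraticForm ℝ ℂ :=
  planeForm (u ^ 2 + (Complex.normSq b₁ + Complex.normSq b₂ + b ^ 2) / 2) ((b₁.im + b₂.im) / 2) 1

/-- The form `D` for which `P ± Re w √D` are the squared eigenvalues of `ℜ (star w • A)`. -/
noncomputable def sqDiscrForm : QuadraticForm ℝ ℂ :=
  planeForm
    (((Complex.normSq b₁ - Complex.normSq b₂) ^ 2 +
      2 * b ^ 2 * (Complex.normSq b₁ + Complex.normSq b₂) + b ^ 4) / 4)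
    (((Complex.normSq b₁ - Complex.normSq b₂) * (b₁.im - b₂.im) + b ^ 2 * (b₁.im + b₂.im)) / 2)
    ((b₁.im - b₂.im) ^ 2 + b ^ 2)

theorem realPart_triangularizedMatrix (w : ℂ) :
    (ℜ (star w • triangularizedMatrix u b₁ b₂ b) : Matrix (Fin 4) (Fin 4) ℂ) =
      !![(w.re * u : ℂ), 0, w.re * conj b₁ - w.im * Complex.I, 0;
         0, w.re * u, w.re * b, w.re * conj b₂ - w.im * Complex.I;
         w.re * b₁ + w.im * Complex.I, w.re * b, -(w.re * u), 0;
         0, w.re * b₂ + w.im * Complex.I, 0, -(w.re * u)] := by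
  rw [realPart_apply_coe, ← Complex.coe_smul]
  ext i j
  fin_cases i <;> fin_cases j <;>
    apply Complex.ext <;> simp [triangularizedMatrix] <;> ring

theorem det_sub_realPart_triangularizedMatrix (w : ℂ) (r : ℝ) :
    (algebraMap ℂ (Matrix (Fin 4) (Fin 4) ℂ) r -
      (ℜ (star w • triangularizedMatrix u b₁ b₂ b) : Matrix (Fin 4) (Fin 4) ℂ)).det =
      (((r ^ 2 - sqMeanForm u b₁ b₂ b w) ^ 2 - w.re ^ 2 * sqDiscrForm b₁ b₂ b w : ℝ) : ℂ) := by
  have hmatrix : algebraMap ℂ (Matrix (Fin 4) (Fin 4) ℂ) r -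
      (ℜ (star w • triangularizedMatrix u b₁ b₂ b) : Matrix (Fin 4) (Fin 4) ℂ) =
      !![(r - w.re * u : ℂ), 0, -(w.re * conj b₁ - w.im * Complex.I), 0;
         0, r - w.re * u, -(w.re * b), -(w.re * conj b₂ - w.im * Complex.I);
         -(w.re * b₁ + w.im * Complex.I), -(w.re * b), r + w.re * u, 0;
         0, -(w.re * b₂ + w.im * Complex.I), 0, r + w.re * u] := by
    rw [realPart_triangularizedMatrix]
    ext i j
    fin_cases i <;> fin_cases j <;> simp [Matrix.algebraMap_matrix_apply]
  rw [hmatrix, det_fin_four_scalar_triangular_blocks]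
  have hβ (c : ℂ) : (w.re * conj c - w.im * Complex.I) * (w.re * c + w.im * Complex.I) =
      ((w.re ^ 2 * Complex.normSq c + 2 * w.re * w.im * c.im + w.im ^ 2 : ℝ) : ℂ) := by
    apply Complex.ext <;> simp [Complex.normSq_apply, sq] <;> ring
  rw [neg_mul_neg, neg_mul_neg, neg_mul_neg, hβ, hβ, sqMeanForm, sqDiscrForm, planeForm_apply,
    planeForm_apply]
  push_cast
  ring

theorem hasKippenhahnQuartic_triangularizedMatrix :
    HasKippenhahnQuartic (triangularizedMatrix u b₁ b₂ b) (sqMeanForm u b₁ b₂ b)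
      (sqDiscrForm b₁ b₂ b) := fun w r => by
  rw [spectrum.mem_iff, Matrix.isUnit_iff_isUnit_det, det_sub_realPart_triangularizedMatrix,
    isUnit_iff_ne_zero, not_not, Complex.ofReal_eq_zero, sub_eq_zero]

theorem posDef_sqDiscrForm_iff : (sqDiscrForm b₁ b₂ b).PosDef ↔ b ≠ 0 := by
  rw [sqDiscrForm, posDef_planeForm_iff]
  constructor
  · rintro ⟨-, h⟩ rfl
    linarith
  · intro hb
    have h₁ := Complex.normSq_nonneg b₁
    have h₂ := Complex.normSq_nonneg b₂
    refine ⟨by positivity, sub_pos.1 ?_⟩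
    calc
      _ = b ^ 2 / 4 * ((b₁.re ^ 2 - b₂.re ^ 2) ^ 2 +
            (b ^ 2 + (b₁.im - b₂.im) ^ 2) * (2 * b₁.re ^ 2 + 2 * b₂.re ^ 2 + (b₁.im - b₂.im) ^ 2) +
            b ^ 2 * (b₁.im - b₂.im) ^ 2 + b ^ 4) := by
        rw [Complex.normSq_apply, Complex.normSq_apply]
        ring
      _ > 0 := by positivity

theorem splitsIntoConics_sqMeanForm_sqDiscrForm_iff :
    SplitsIntoConics (sqMeanForm u b₁ b₂ b) (sqDiscrForm b₁ b₂ b) ↔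
      b ≠ 0 ∧ ((b₁.im = b₂.im ∧ 4 * b ^ 2 * u ^ 2 = (b₁.re ^ 2 - b₂.re ^ 2) ^ 2) ∨
          (u = 0 ∧ b₁.re = 0 ∧ b₂.re = 0)) := by
  rw [sqMeanForm, sqDiscrForm, splitsIntoConics_iff, ← sqDiscrForm, posDef_sqDiscrForm_iff,
    Complex.normSq_apply, Complex.normSq_apply]
  refine and_congr_right fun hb => ⟨fun ⟨hq, hp⟩ => ?_, ?_⟩
  · have hδ : (b₁.im - b₂.im) * (b₁.re ^ 2 - b₂.re ^ 2) = 0 := by linear_combination 2 * hq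
    rcases eq_or_ne b₁.im b₂.im with him | him
    · rw [him] at hp
      exact Or.inl ⟨him, by linear_combination -hp⟩
    · right
      have him' : b₁.im - b₂.im ≠ 0 := sub_ne_zero.2 him
      have hre : b₁.re ^ 2 = b₂.re ^ 2 :=
        sub_eq_zero.1 ((mul_eq_zero.1 hδ).resolve_left him')
      have hsum : u ^ 2 * ((b₁.im - b₂.im) ^ 2 + b ^ 2) + b₁.re ^ 2 * (b₁.im - b₂.im) ^ 2 = 0 := by
        linear_combination (-1 / 4) * hp +
          ((b₁.re ^ 2 - b₂.re ^ 2) / 4 + b₁.im * (b₁.im - b₂.im)) * hre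
      obtain ⟨hu, h₁⟩ := (add_eq_zero_iff_of_nonneg (by positivity) (by positivity)).1 hsum
      have h₁' : b₁.re = 0 := by simpa [him'] using h₁
      refine ⟨?_, h₁', ?_⟩
      · exact pow_eq_zero_iff two_ne_zero |>.1 ((mul_eq_zero.1 hu).resolve_right (by positivity))
      · simpa [h₁'] using hre.symm
  · rintro (⟨him, h⟩ | ⟨hu, h₁, h₂⟩)
    · constructor
      · rw [him]; ring
      · rw [him]; linear_combination -h
    · constructor <;> rw [h₁, h₂]
      · ring
      · rw [hu]; ring

end TriangularizedMatrix

theorem theorem4p1_general (u : ℝ) (b₁ b₂ : ℂ) (b : ℝ) :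
    IsBiElliptical (numericalRange (triangularizedMatrix (u : ℂ) b₁ b₂ b)) ↔
      b ≠ 0 ∧
        ((b₁.im = b₂.im ∧ 4 * b ^ 2 * u ^ 2 = (b₁.re ^ 2 - b₂.re ^ 2) ^ 2) ∨
          (u = 0 ∧ b₁.re = 0 ∧ b₂.re = 0)) :=
  (hasKippenhahnQuartic_triangularizedMatrix u b₁ b₂ b).isBiElliptical_iff.trans
    (splitsIntoConics_sqMeanForm_sqDiscrForm_iff u b₁ b₂ b)

theorem theorem4p1 (u : ℝ) (b₁ b₂ : ℂ) (b : ℝ) (hb : 0 ≤ b) :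
    IsBiElliptical (numericalRange (triangularizedMatrix (u : ℂ) b₁ b₂ b)) ↔
      b ≠ 0 ∧
        ((b₁.im = b₂.im ∧ 4 * b ^ 2 * u ^ 2 = (b₁.re ^ 2 - b₂.re ^ 2) ^ 2) ∨
          (u = 0 ∧ b₁.re = 0 ∧ b₂.re = 0)) :=
  theorem4p1_general u b₁ b₂ b
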